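/- Let $q\ge 3$ be a prime power, let $n\ge 1$ be an integer, and let $\mathbb{F}_qP^n$ be the $n$-dimensional projective space over the field $\mathbb{F}_q$, i.e. the set of lines through the origin of $\mathbb{F}_q^{n+1}$. A flat is the set of points given by a linear subspace $U\subseteq\mathbb{F}_q^{n+1}$; its dimension is $\dim U-1$ (so $\emptyset$ is a flat of dimension $-1$). An almost-flat is a subset of $\mathbb{F}_qP^n$ that is either a flat or a $d$-flat (a flat of dimension $d$) minus a flat of dimension at most $d-1$, for some $d$. Let $\{A^i\}_{i=1}^N$ be a partition of $(\mathbb{F}_qP^n)^n$ (into pairwise disjoint, possibly empty sets) such that 1. every part is a product $A^i=A^i_1\times\dots\times A^i_n$ with $A^i_j\subseteq\mathbb{F}_qP^n$; 2. for every $i$ there is an $(n-1)$-dimensional flat $L^i\subseteq\mathbb{F}_qP^n$ with $A^i\subseteq(L^i)^n$; 3. every factor $A^i_j$ is an almost-flat. Then $$N\;\ge\; q^{n(n+1)/2}\left(1-\frac1q\left(\frac{q+1}{q-2}\right)^{n}\right).$$ -/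

import Mathlib

open scoped LinearAlgebra.Projectivization

namespace DPP

/-- The `n`-dimensional projective space over the field `F`: the lines through the origin
of `F ^ (n + 1)`. -/
abbrev PSpace (F : Type*) [Field F] (n : ℕ) : Type _ := ℙ F (Fin (n + 1) → F)

/-- The flats of `PSpace F n`, the empty flat included. They correspond to the linear subspaces
of `F ^ (n + 1)` through `Projectivization.Subspace.submodule`. -/
abbrev Flat (F : Type*) [Field F] (n : ℕ) : Type _ :=
  Projectivization.Subspace F (Fin (n + 1) → F)

/-- The projective dimension of a flat; the empty flat has dimension `-1`. -/
noncomputable def Flat.dim {F : Type*} [Field F] {n : ℕ} (L : Flat F n) : ℤ :=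
  (Module.finrank F (Projectivization.Subspace.submodule L) : ℤ) - 1

/-- An almost-flat is a flat, or a `k`-flat minus a flat of dimension at most `k - 1`. -/
def IsAlmostFlat {F : Type*} [Field F] {n : ℕ} (A : Set (PSpace F n)) : Prop :=
  (∃ L : Flat F n, A = (L : Set (PSpace F n))) ∨
    ∃ L M : Flat F n, Flat.dim M ≤ Flat.dim L - 1 ∧
      A = (L : Set (PSpace F n)) \ (M : Set (PSpace F n))

/-- The `i`-th part, the product of the sets `A i 1, …, A i k`. -/
def part {F : Type*} [Field F] {n k N : ℕ} (A : Fin N → Fin k → Set (PSpace F n)) (i : Fin N) :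
    Set (Fin k → PSpace F n) :=
  {x | ∀ j, x j ∈ A i j}

/-- The `N` product sets with the given factors partition the set of `k`-tuples of points of
`PSpace F n`, and each of them lies in the `k`-th power of a `(k - 1)`-flat.
Empty parts are permitted; each counts towards `N`. -/
structure IsValidPartition {F : Type*} [Field F] {n k N : ℕ}
    (A : Fin N → Fin k → Set (PSpace F n)) : Prop where
  disjoint : ∀ i i', i ≠ i' → Disjoint (part A i) (part A i')
  cover : ⋃ i, part A i = Set.univ
  subset_flat : ∀ i, ∃ L : Flat F n, Flat.dim L = (k : ℤ) - 1 ∧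
    part A i ⊆ {x | ∀ j, x j ∈ L}

end DPP

/-! Over each almost-flat lies a set `U \ W` of nonzero vectors, so the parts become boxes of such
sets partitioning the n-tuples of nonzero vectors of F^(n+1). Each box lies in `L^n` with `L` of
linear dimension n, where a determinant detects independence.

A box of independent tuples only is small, with at most M = (q-1)^n q^(n(n-1)/2) elements
(`prod_card_le_of_linearIndependent`): each `W i` is a hyperplane of `U i`, and the `W i` are forced
into a triangular pattern. Any other box is rich in dependent tuples, because a multilinear form
that vanishes somewhere on it vanishes often (`prod_card_le_card_zeros`). Dependent tuples are rare
overall, a proportion of at most 1/(q(q-1)) (`card_not_linearIndependent_le`), so boxes of the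
second kind cover little and about (q^(n+1)-1)^n / M small boxes are needed. `le_card_of_partition`
adds this up. -/

namespace DPP

open Module Finset


/-! ### Zeros of a linear form on a difference of subspaces -/

section Counting

variable {F V : Type*} [Field F] [Fintype F] [AddCommGroup V] [Module F V] [Fintype V]

lemma natCard_eq_mul_natCard_inf_ker (U : Submodule F V) (h : V →ₗ[F] F) {u : V} (hu : u ∈ U)
    (hne : h u ≠ 0) :
    Nat.card U = Fintype.card F * Nat.card (U ⊓ LinearMap.ker h : Submodule F V) := by
  have hr : LinearMap.range (h.domRestrict U) = ⊤ := by
    refine LinearMap.range_eq_top.2 (LinearMap.surjective fun h0 => hne ?_)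
    simpa using LinearMap.congr_fun h0 ⟨u, hu⟩
  have hk : finrank F (LinearMap.ker (h.domRestrict U)) =
      finrank F (U ⊓ LinearMap.ker h : Submodule F V) := by
    rw [← Submodule.map_comap_subtype, Submodule.finrank_map_subtype_eq]
    rfl
  have h1 := LinearMap.finrank_range_add_finrank_ker (h.domRestrict U)
  rw [hr, finrank_top, finrank_self, hk] at h1
  rw [natCard_eq_pow_finrank (K := F) (V := U), ← h1, natCard_eq_pow_finrank (K := F)
    (V := (U ⊓ LinearMap.ker h : Submodule F V)), Nat.card_eq_fintype_card, pow_add, pow_one]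

lemma mul_natCard_le_of_notMem {U W : Submodule F V} (hWU : W ≤ U) {z : V} (hz : z ∈ U)
    (hzW : z ∉ W) : Fintype.card F * Nat.card W ≤ Nat.card U := by
  obtain ⟨l, hl, hle⟩ := Submodule.exists_le_ker_of_notMem hzW
  rw [natCard_eq_mul_natCard_inf_ker U l hz hl]
  exact Nat.mul_le_mul_left _
    (Nat.card_mono (Set.toFinite _) (SetLike.coe_subset_coe.2 (le_inf hWU hle)))

open Classical in
/-- The vectors of `U` outside `W`. -/
noncomputable def diffFinset (U W : Submodule F V) : Finset V := {v | v ∈ U ∧ v ∉ W}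

omit [Fintype F] in
@[simp]
lemma mem_diffFinset {U W : Submodule F V} {v : V} : v ∈ diffFinset U W ↔ v ∈ U ∧ v ∉ W := by
  simp [diffFinset]

omit [Fintype F] in
lemma card_diffFinset_add (U W : Submodule F V) :
    #(diffFinset U W) + Nat.card (U ⊓ W : Submodule F V) = Nat.card U := by
  classical
  have h1 : Nat.card U = #({v | v ∈ U} : Finset V) := Nat.subtype_card _ (by simp)
  have h2 : Nat.card (U ⊓ W : Submodule F V) = #({v | v ∈ U ∧ v ∈ W} : Finset V) :=
    Nat.subtype_card _ (by simp)
  rw [h1, h2, ← card_filter_add_card_filter_not (s := {v | v ∈ U}) (fun v => v ∉ W)]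
  simp only [filter_filter, not_not]
  congr 2

omit [Fintype F] in
lemma card_diffFinset_add_of_le {U W : Submodule F V} (hWU : W ≤ U) :
    #(diffFinset U W) + Nat.card W = Nat.card U := by
  have := card_diffFinset_add U W
  rwa [inf_eq_right.2 hWU] at this

omit [Fintype F] in
open Classical in
lemma filter_diffFinset_eq (U W : Submodule F V) (h : V →ₗ[F] F) :
    {v ∈ diffFinset U W | h v = 0} = diffFinset (U ⊓ LinearMap.ker h) W := by
  ext
  simp only [mem_filter, mem_diffFinset, Submodule.mem_inf, LinearMap.mem_ker]
  tauto

open Classical in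
/-- A linear form with a zero in `U \ W` vanishes on a proportion at least `1 / (q + 1)`. -/
lemma card_diffFinset_le_mul_card_zeros {U W : Submodule F V} (hWU : W ≤ U) (h : V →ₗ[F] F)
    {z : V} (hz : z ∈ diffFinset U W) (hz0 : h z = 0) :
    #(diffFinset U W) ≤ (Fintype.card F + 1) * #{v ∈ diffFinset U W | h v = 0} := by
  rw [mem_diffFinset] at hz
  by_cases hU : ∀ u ∈ U, h u = 0
  · rw [filter_true_of_mem fun v hv => hU v (mem_diffFinset.1 hv).1]
    nlinarith
  push Not at hU
  obtain ⟨u, huU, hu⟩ := hU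
  have e1 := natCard_eq_mul_natCard_inf_ker U h huU hu
  have e2 := card_diffFinset_add_of_le hWU
  have e3 := card_diffFinset_add (U ⊓ LinearMap.ker h) W
  rw [filter_diffFinset_eq]
  -- If `h` kills `W`, the zero `z` makes `W` proper in `U ⊓ ker h`, so `q * |W| ≤ |U ⊓ ker h|`;
  -- equality here gives exactly 1/(q+1). Otherwise the proportion is 1/q.
  by_cases hW : W ≤ LinearMap.ker h
  · have hWK : W ≤ U ⊓ LinearMap.ker h := le_inf hWU hW
    rw [inf_eq_right.2 hWK] at e3
    have e4 := mul_natCard_le_of_notMem hWK (z := z) ⟨hz.1, hz0⟩ hz.2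
    nlinarith
  · obtain ⟨w, hw, hwh⟩ := SetLike.not_le_iff_exists.1 hW
    have e4 := natCard_eq_mul_natCard_inf_ker W h hw hwh
    have e5 : U ⊓ LinearMap.ker h ⊓ W = W ⊓ LinearMap.ker h := by
      rw [inf_right_comm, inf_eq_right.2 hWU]
    rw [e5] at e3
    nlinarith

open Classical in
/-- A linear form that is nonzero somewhere on `U \ W` is nonzero on a proportion at least
`(q - 2) / (q + 1)`. -/
lemma mul_card_diffFinset_le_mul_card_ne {U W : Submodule F V} (hWU : W ≤ U) (h : V →ₗ[F] F)
    {z : V} (hz : z ∈ diffFinset U W) (hz0 : h z ≠ 0) :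
    ((Fintype.card F : ℝ) - 2) * #(diffFinset U W) ≤
      (Fintype.card F + 1) * #{v ∈ diffFinset U W | h v ≠ 0} := by
  rw [mem_diffFinset] at hz
  have hq : (1 : ℝ) ≤ Fintype.card F := by exact_mod_cast Fintype.card_pos
  have e0 := card_filter_add_card_filter_not (s := diffFinset U W) (fun v => h v = 0)
  have e1 := natCard_eq_mul_natCard_inf_ker U h hz.1 hz0
  have e2 := card_diffFinset_add_of_le hWU
  have e3 := card_diffFinset_add (U ⊓ LinearMap.ker h) W
  rw [filter_diffFinset_eq] at e0
  simp only [ne_eq]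
  generalize #{v ∈ diffFinset U W | ¬ h v = 0} = c at *
  generalize #(diffFinset U W) = a at *
  generalize #(diffFinset (U ⊓ LinearMap.ker h) W) = b at *
  -- In both cases the true proportion is at least (q-1)/q; the weaker constant suffices.
  by_cases hW : W ≤ LinearMap.ker h
  · have hWK : W ≤ U ⊓ LinearMap.ker h := le_inf hWU hW
    rw [inf_eq_right.2 hWK] at e3
    generalize Nat.card (U ⊓ LinearMap.ker h : Submodule F V) = k at *
    generalize Nat.card W = w at *
    generalize Nat.card U = u at *
    subst e1
    rify at *
    have hc : (c : ℝ) = (Fintype.card F - 1) * k := by linarith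
    have hw : (0 : ℝ) ≤ w := w.cast_nonneg
    have hb : (0 : ℝ) ≤ b := b.cast_nonneg
    have hbk : (b : ℝ) ≤ k := by linarith
    nlinarith
  · obtain ⟨w, hw, hwh⟩ := SetLike.not_le_iff_exists.1 hW
    have e4 := natCard_eq_mul_natCard_inf_ker W h hw hwh
    have e5 : U ⊓ LinearMap.ker h ⊓ W = W ⊓ LinearMap.ker h := by
      rw [inf_right_comm, inf_eq_right.2 hWU]
    rw [e5] at e3
    rify at *
    have hb : (0 : ℝ) ≤ b := b.cast_nonneg
    have ha : (a : ℝ) = Fintype.card F * b := by nlinarith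
    have hc : (c : ℝ) = (Fintype.card F - 1) * b := by linarith
    rw [ha, hc]
    nlinarith [mul_nonneg (sub_nonneg.2 hq) hb]

end Counting

/-! ### Changing tuples one coordinate at a time -/

section Update

variable {ι X : Type*} [Fintype ι] [DecidableEq ι]

/-- Two points of a product that differ on a predicate can be replaced by two points that differ
in one coordinate only. -/
lemma exists_update_of_piFinset {P : (ι → X) → Prop} {B : ι → Finset X} {x z : ι → X}
    (hx : x ∈ Fintype.piFinset B) (hz : z ∈ Fintype.piFinset B) (hPx : P x) (hPz : ¬ P z) :
    ∃ i, ∃ y ∈ Fintype.piFinset B, P y ∧ ¬ P (Function.update y i (z i)) := by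
  by_contra! H
  rw [Fintype.mem_piFinset] at hx hz
  have key : ∀ s : Finset ι, P (s.piecewise z x) := by
    intro s
    induction s using Finset.induction_on with
    | empty => simpa using hPx
    | insert i s his ih =>
      rw [piecewise_insert]
      refine H i _ (Fintype.mem_piFinset.2 fun j => ?_) ih
      by_cases hj : j ∈ s <;> simp [hj, hx, hz]
  exact hPz (by simpa using key univ)

-- Double counting: since coordinate `i` is constant on `S`, the pair `(x, t)` can be recovered from
-- `Function.update x i t`.
open Classical in
lemma mul_card_le_card_of_update {S T : Finset (ι → X)} {i : ι} {B : Finset X} {y : X} {r : ℝ}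
    (hS : ∀ x ∈ S, x i = y) (h : ∀ x ∈ S, r ≤ #{t ∈ B | Function.update x i t ∈ T}) :
    r * #S ≤ #T := by
  have h1 : #(S.sigma fun x => {t ∈ B | Function.update x i t ∈ T}) ≤ #T := by
    refine card_le_card_of_injOn (fun p => Function.update p.1 i p.2) ?_ ?_
    · rintro ⟨x, t⟩ hp
      simp only [coe_sigma, Set.mem_sigma_iff, mem_coe, mem_filter] at hp
      exact hp.2.2
    · rintro ⟨x, t⟩ hp ⟨x', t'⟩ hp' heq
      simp only [coe_sigma, Set.mem_sigma_iff, mem_coe, mem_filter] at hp hp' heq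
      have ht : t = t' := by simpa using congrFun heq i
      have hx : x = x' := by
        funext j
        by_cases hj : j = i
        · subst hj
          rw [hS x hp.1, hS x' hp'.1]
        · simpa [hj] using congrFun heq j
      subst ht hx
      rfl
  rw [card_sigma] at h1
  calc r * #S = ∑ x ∈ S, r := by rw [sum_const, nsmul_eq_mul, mul_comm]
    _ ≤ ∑ x ∈ S, (#{t ∈ B | Function.update x i t ∈ T} : ℝ) := sum_le_sum h
    _ ≤ #T := by exact_mod_cast h1

open Classical in
/-- A predicate that keeps holding for a proportion `ρ` of the changes of any one coordinate holds
for a proportion `ρ ^ k` of the changes of `k` coordinates. -/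
lemma pow_mul_prod_card_le_card {P : (ι → X) → Prop} [DecidablePred P]
    {B : ι → Finset X} {ρ : ℝ} (hρ : 0 ≤ ρ)
    {y : ι → X} (hy : y ∈ Fintype.piFinset B) (hPy : P y)
    (hP : ∀ x ∈ Fintype.piFinset B, P x → ∀ i,
      ρ * #(B i) ≤ #{t ∈ B i | P (Function.update x i t)}) (s : Finset ι) :
    ρ ^ #s * ∏ i ∈ s, (#(B i) : ℝ) ≤
      #{x ∈ Fintype.piFinset B | (∀ i ∉ s, x i = y i) ∧ P x} := by
  induction s using Finset.induction_on with
  | empty =>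
    have : y ∈ ({x ∈ Fintype.piFinset B | (∀ i ∉ (∅ : Finset ι), x i = y i) ∧ P x} :
      Finset (ι → X)) := by simp only [mem_filter]; exact ⟨hy, by simp, hPy⟩
    simpa using card_pos.2 ⟨y, this⟩
  | insert i s his ih =>
    refine le_trans ?_ (mul_card_le_card_of_update (B := B i) (i := i) (y := y i)
      (S := {x ∈ Fintype.piFinset B | (∀ i ∉ s, x i = y i) ∧ P x}) (r := ρ * #(B i)) ?_ ?_)
    · rw [card_insert_of_notMem his, prod_insert his, pow_succ]
      calc _ = ρ * #(B i) * (ρ ^ #s * ∏ i ∈ s, (#(B i) : ℝ)) := by ring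
        _ ≤ _ := by gcongr
    · intro x hx
      exact (mem_filter.1 hx).2.1 i his
    · intro x hx
      obtain ⟨hxB, hxy, hPx⟩ := mem_filter.1 hx
      refine (hP x hxB hPx i).trans ?_
      gcongr with t ht
      intro hPt
      refine mem_filter.2 ⟨Fintype.mem_piFinset.2 fun j => ?_, fun j hj => ?_, hPt⟩
      · by_cases hj : j = i
        · subst hj
          simpa using ht
        · simpa [hj] using Fintype.mem_piFinset.1 hxB j
      · rw [mem_insert, not_or] at hj
        simpa [hj.1] using hxy j hj.2

end Update


/-! ### Zeros of a multilinear form on a box -/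

section Multilinear

variable {F V ι : Type*} [Field F] [Fintype F] [AddCommGroup V] [Module F V] [Fintype V]
  [Fintype ι] [DecidableEq ι]

open Classical in
/-- A multilinear form with both a zero and a nonzero value on a product of sets `U \ W` vanishes
on a substantial proportion of the product. -/
lemma prod_card_le_card_zeros (f : MultilinearMap F (fun _ : ι => V) F)
    {U W : ι → Submodule F V} (hWU : ∀ i, W i ≤ U i) (hq : 2 ≤ Fintype.card F) {x z : ι → V}
    (hx : x ∈ Fintype.piFinset fun i => diffFinset (U i) (W i))
    (hz : z ∈ Fintype.piFinset fun i => diffFinset (U i) (W i)) (hfx : f x ≠ 0) (hfz : f z = 0) :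
    (((Fintype.card F : ℝ) - 2) / (Fintype.card F + 1)) ^ (Fintype.card ι - 1) *
        (1 / (Fintype.card F + 1)) * ∏ i, (#(diffFinset (U i) (W i)) : ℝ) ≤
      #{v ∈ Fintype.piFinset fun i => diffFinset (U i) (W i) | f v = 0} := by
  obtain ⟨i, y, hy, hfy, hfyz⟩ := exists_update_of_piFinset (P := fun v => f v ≠ 0)
    hx hz hfx (not_not.2 hfz)
  rw [not_not] at hfyz
  have hq' : (2 : ℝ) ≤ Fintype.card F := by exact_mod_cast hq
  have hzi := mem_diffFinset.1 (Fintype.mem_piFinset.1 hz i)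
  have hyi := mem_diffFinset.1 (Fintype.mem_piFinset.1 hy i)
  -- Correcting `y i` by a multiple of `z i` leaves the value of `f` unchanged and puts `w` in `ker
  -- l`. Adding multiples of `w` to `z i` then never leads into `W i`, although `w` itself may lie
  -- there.
  obtain ⟨l, hl, hle⟩ := Submodule.exists_le_ker_of_notMem hzi.2
  set w : V := y i - (l (y i) / l (z i)) • z i with hw
  have hwU : w ∈ U i := (U i).sub_mem hyi.1 ((U i).smul_mem _ hzi.1)
  have hlw : l w = 0 := by simp [hw, hl]
  have hfw : f (Function.update y i w) ≠ 0 := by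
    rw [hw, f.map_update_sub, f.map_update_smul, hfyz, Function.update_eq_self]
    simpa using hfy
  have hρ : (0 : ℝ) ≤ ((Fintype.card F : ℝ) - 2) / (Fintype.card F + 1) :=
    div_nonneg (by linarith) (by positivity)
  have h1 := pow_mul_prod_card_le_card (P := fun x => f (Function.update x i w) ≠ 0) hρ hy hfw ?_
    (univ.erase i)
  · rw [card_erase_of_mem (mem_univ i), card_univ] at h1
    have h2 := mul_card_le_card_of_update (i := i) (y := y i) (B := diffFinset (U i) (W i))
      (T := {v ∈ Fintype.piFinset fun i => diffFinset (U i) (W i) | f v = 0})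
      (S := {x ∈ Fintype.piFinset fun i => diffFinset (U i) (W i) |
        (∀ j ∉ univ.erase i, x j = y j) ∧ f (Function.update x i w) ≠ 0})
      (r := 1 / (Fintype.card F + 1) * #(diffFinset (U i) (W i))) ?_ ?_
    · rw [← mul_prod_erase univ _ (mem_univ i)]
      refine le_trans ?_ h2
      calc _ = 1 / (Fintype.card F + 1) * #(diffFinset (U i) (W i)) *
            ((((Fintype.card F : ℝ) - 2) / (Fintype.card F + 1)) ^ (Fintype.card ι - 1) *
              ∏ j ∈ univ.erase i, (#(diffFinset (U j) (W j)) : ℝ)) := by ring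
        _ ≤ _ := mul_le_mul_of_nonneg_left h1 (by positivity)
    · intro v hv
      exact (mem_filter.1 hv).2.1 i (by simp)
    · intro v hv
      obtain ⟨hvB, -, hfv⟩ := mem_filter.1 hv
      set h : V →ₗ[F] F := f.toLinearMap v i with hh
      have hhw : h w ≠ 0 := hfv
      -- A nonzero value at `w` thus yields a zero outside `W i`, as needed for the proportion
      -- 1/(q+1) in coordinate `i`.
      have hmem : z i - (h (z i) / h w) • w ∈ diffFinset (U i) (W i) := by
        refine mem_diffFinset.2 ⟨(U i).sub_mem hzi.1 ((U i).smul_mem _ hwU), fun hW => hl ?_⟩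
        have := hle hW
        rw [LinearMap.mem_ker] at this
        simpa [hlw] using this
      have h3 := card_diffFinset_le_mul_card_zeros (hWU i) h hmem (by simp [hhw])
      have h4 : #{t ∈ diffFinset (U i) (W i) | h t = 0} ≤ #{t ∈ diffFinset (U i) (W i) |
          Function.update v i t ∈ ({v ∈ Fintype.piFinset fun i => diffFinset (U i) (W i) |
            f v = 0} : Finset (ι → V))} := by
        refine card_le_card fun t ht => ?_
        rw [mem_filter] at ht ⊢
        refine ⟨ht.1, mem_filter.2 ⟨Fintype.mem_piFinset.2 fun j => ?_, ht.2⟩⟩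
        by_cases hj : j = i
        · subst hj
          simpa using ht.1
        · simpa [hj] using Fintype.mem_piFinset.1 hvB j
      refine le_trans ?_ (Nat.cast_le.2 h4)
      rw [one_div, inv_mul_le_iff₀ (by positivity)]
      exact_mod_cast h3
  · intro v hv hfv j
    rw [div_mul_eq_mul_div, div_le_iff₀ (by positivity), mul_comm _ ((Fintype.card F : ℝ) + 1)]
    -- Coordinate `i` is overwritten by `w`, so changing it does not affect the predicate.
    by_cases hj : j = i
    · subst hj
      refine le_trans ?_ (mul_le_mul_of_nonneg_left (Nat.cast_le.2 (card_le_card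
        (s := diffFinset (U j) (W j)) fun t ht => mem_filter.2 ⟨ht, by simpa using hfv⟩))
        (by positivity))
      gcongr
      linarith
    · have h2 := mul_card_diffFinset_le_mul_card_ne (hWU j)
        (f.toLinearMap (Function.update v i w) j) (z := v j) (Fintype.mem_piFinset.1 hv j)
        (by
          have : Function.update (Function.update v i w) j (v j) = Function.update v i w := by
            rw [Function.update_comm (Ne.symm hj), Function.update_eq_self]
          simpa [this] using hfv)
      simpa [Function.update_comm (Ne.symm hj)] using h2

end Multilinear

/-! ### Boxes of independent tuples -/

section Independent

variable {F V : Type*} [Field F] [AddCommGroup V] [Module F V]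

/-- A multilinear form that detects linear independence of `n`-tuples in a subspace of
dimension `n`. -/
lemma exists_multilinearMap_ne_zero_iff {n : ℕ} {L : Submodule F V} [FiniteDimensional F L]
    (hL : finrank F L = n) :
    ∃ f : MultilinearMap F (fun _ : Fin n => V) F,
      ∀ x : Fin n → V, (∀ j, x j ∈ L) → (f x ≠ 0 ↔ LinearIndependent F x) := by
  obtain ⟨p, hp⟩ := L.subtype.exists_leftInverse_of_injective (Submodule.ker_subtype L)
  let b : Basis (Fin n) F L := finBasisOfFinrankEq F L hL
  refine ⟨b.det.toMultilinearMap.compLinearMap fun _ => p, fun x hx => ?_⟩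
  have hpx : ∀ j, p (x j) = ⟨x j, hx j⟩ := fun j => LinearMap.congr_fun hp ⟨x j, hx j⟩
  have h1 := Module.Basis.is_basis_iff_det b (v := fun j => (⟨x j, hx j⟩ : L))
  have h2 : LinearIndependent F (fun j => (⟨x j, hx j⟩ : L)) ↔ LinearIndependent F x :=
    (L.subtype.linearIndependent_iff (Submodule.ker_subtype L)).symm
  have h3 : LinearIndependent F (fun j => (⟨x j, hx j⟩ : L)) →
      Submodule.span F (Set.range fun j => (⟨x j, hx j⟩ : L)) = ⊤ := fun h =>
    h.span_eq_top_of_card_eq_finrank' (by simp [hL])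
  rw [← h2]
  simp only [MultilinearMap.compLinearMap_apply, hpx, AlternatingMap.coe_multilinearMap]
  rw [← isUnit_iff_ne_zero, ← h1]
  exact ⟨fun h => h.1, fun h => ⟨h, h3 h⟩⟩

/-- If all translates of a linearly independent family by elements of `∏ i, W i` are linearly
independent, then for any nonempty `S` some `W i` with `i ∈ S` has no component along the vectors
indexed by `S`. -/
lemma exists_le_span_image_compl {n : ℕ} {a : Fin n → V} (ha : LinearIndependent F a)
    {W : Fin n → Submodule F V} (hW : ∀ i, W i ≤ Submodule.span F (Set.range a))
    (hli : ∀ w : Fin n → V, (∀ i, w i ∈ W i) → LinearIndependent F (a + w))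
    {S : Finset (Fin n)} (hS : S.Nonempty) :
    ∃ i ∈ S, W i ≤ Submodule.span F (a '' (S : Set (Fin n))ᶜ) := by
  classical
  have hc : ∃ c : Fin n → V →ₗ[F] F,
      ∀ v ∈ Submodule.span F (Set.range a), ∑ k, c k v • a k = v := by
    choose c hc using fun k => ((Basis.span ha).coord k).exists_extend
    refine ⟨c, fun v hv => ?_⟩
    have h1 := congrArg Subtype.val ((Basis.span ha).sum_repr ⟨v, hv⟩)
    simp only [AddSubmonoidClass.coe_finsetSum, Submodule.coe_smul, Basis.span_apply] at h1
    convert h1 using 3 with k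
    exact LinearMap.congr_fun (hc k) ⟨v, hv⟩
  obtain ⟨c, hc⟩ := hc
  have key : ∀ S : Finset (Fin n), S.Nonempty →
      (∀ i ∈ S, ∃ k ∈ S, ∃ v ∈ W i, c k v ≠ 0) → False := by
    intro S
    induction S using Finset.strongInduction with
    | H S ih =>
    intro hS hE
    -- Since `S` is a minimal counterexample, deleting `k` leaves some `i` for which `W i` can have
    -- only a `k`-component within `S`. The resulting `g` is a permutation of `S`.
    have hg : ∀ k ∈ S, ∃ i ∈ S, ∀ k' ∈ S, (∃ v ∈ W i, c k' v ≠ 0) → k' = k := by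
      intro k hk
      rcases (S.erase k).eq_empty_or_nonempty with h0 | h0
      · refine ⟨k, hk, fun k' hk' _ => ?_⟩
        by_contra hne
        simpa [h0] using mem_erase.2 ⟨hne, hk'⟩
      · obtain ⟨i, hi, hik⟩ : ∃ i ∈ S.erase k, ∀ k' ∈ S.erase k, ∀ v ∈ W i, c k' v = 0 := by
          by_contra! H
          exact ih _ (erase_ssubset hk) h0 H
        refine ⟨i, mem_of_mem_erase hi, fun k' hk' ⟨v, hv, hcv⟩ => ?_⟩
        by_contra hne
        exact hcv (hik k' (mem_erase.2 ⟨hne, hk'⟩) v hv)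
    choose! g hgS hgk using hg
    choose! t htS v hvW hcv using hE
    have htg : ∀ k ∈ S, t (g k) = k := fun k hk =>
      hgk k hk _ (htS _ (hgS k hk)) ⟨_, hvW _ (hgS k hk), hcv _ (hgS k hk)⟩
    have hsurj : Set.SurjOn g S S := surjOn_of_injOn_of_card_le g hgS
      (fun k hk k' hk' h => by rw [← htg k hk, ← htg k' hk', h]) le_rfl
    have huniq : ∀ k ∈ S, ∀ i ∈ S, i ≠ g k → c k (v i) = 0 := by
      intro k hk i hi hne
      by_contra h
      obtain ⟨k', hk', rfl⟩ := hsurj hi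
      exact hne (by rw [hgk k' hk' k hk ⟨_, hvW _ hi, h⟩])
    set u : V := ∑ i ∈ S, v i with hu
    have hcu : ∀ k ∈ S, c k u ≠ 0 := by
      intro k hk
      rw [hu, map_sum, sum_eq_single (g k) (fun i hi hne => huniq k hk i hi hne)
        (fun h => absurd (hgS k hk) h)]
      have := hcv _ (hgS k hk)
      rwa [htg k hk] at this
    have huspan : u ∈ Submodule.span F (Set.range a) :=
      Submodule.sum_mem _ fun i hi => hW i (hvW i hi)
    -- With coefficients `c k u` the translated family sums to `u - ∑ k ∈ S, v k = 0`, a nontrivial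
    -- relation.
    have h1 := hli (fun k => if k ∈ S then -(c k u)⁻¹ • v k else 0) fun k => by
      split_ifs with hk
      · exact (W k).smul_mem _ (hvW k hk)
      · exact (W k).zero_mem
    rw [Fintype.linearIndependent_iff] at h1
    obtain ⟨k, hk⟩ := hS
    refine hcu k hk (h1 (fun k => c k u) ?_ k)
    simp only [Pi.add_apply, smul_add, sum_add_distrib, hc u huspan]
    have h2 : ∑ k, c k u • (if k ∈ S then -(c k u)⁻¹ • v k else 0) =
        ∑ k, if k ∈ S then -v k else 0 := by
      refine sum_congr rfl fun k _ => ?_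
      split_ifs with hk
      · rw [neg_smul, smul_neg, smul_smul, mul_inv_cancel₀ (hcu k hk), one_smul]
      · exact smul_zero _
    rw [h2, sum_ite_mem, univ_inter, sum_neg_distrib, ← hu, add_neg_cancel]
  by_contra! H
  refine key S hS fun i hi => ?_
  obtain ⟨v, hv, hvn⟩ := SetLike.not_le_iff_exists.1 (H i hi)
  by_contra! h
  refine hvn ?_
  rw [← hc v (hW i hv)]
  refine Submodule.sum_mem _ fun k _ => ?_
  by_cases hk : k ∈ S
  · rw [h k hk v hv, zero_smul]
    exact Submodule.zero_mem _
  · exact Submodule.smul_mem _ _ (Submodule.subset_span ⟨k, by simpa using hk, rfl⟩)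

variable [Fintype F]

/-- Some `W i` with `i ∈ S` lies in the span of the `n - #S` vectors outside `S`; remove that `i`
and repeat. -/
lemma prod_natCard_le_prod_range {n : ℕ} {a : Fin n → V} (ha : LinearIndependent F a)
    {W : Fin n → Submodule F V} (hW : ∀ i, W i ≤ Submodule.span F (Set.range a))
    (hli : ∀ w : Fin n → V, (∀ i, w i ∈ W i) → LinearIndependent F (a + w)) (m : ℕ)
    (S : Finset (Fin n)) (hS : #S = m) :
    ∏ i ∈ S, Nat.card (W i) ≤ ∏ j ∈ range m, Fintype.card F ^ (n - 1 - j) := by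
  classical
  induction m generalizing S with
  | zero => simp [card_eq_zero.1 hS]
  | succ m ih =>
    obtain ⟨i, hi, hWi⟩ := exists_le_span_image_compl ha hW hli (card_pos.1 (by omega : 0 < #S))
    rw [← mul_prod_erase S _ hi, prod_range_succ, mul_comm]
    refine Nat.mul_le_mul (ih _ (by rw [card_erase_of_mem hi, hS]; rfl)) ?_
    have hfin : FiniteDimensional F (Submodule.span F (a '' (S : Set (Fin n))ᶜ)) :=
      FiniteDimensional.span_of_finite F (Set.toFinite _)
    have : FiniteDimensional F (W i) := Submodule.finiteDimensional_of_le hWi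
    rw [natCard_eq_pow_finrank (K := F) (V := W i), Nat.card_eq_fintype_card]
    refine Nat.pow_le_pow_right Fintype.card_pos ((Submodule.finrank_mono hWi).trans ?_)
    have h1 : (a '' (S : Set (Fin n))ᶜ) = ((Sᶜ.image a : Finset V) : Set V) := by simp
    rw [h1]
    refine (finrank_span_finset_le_card _).trans (card_image_le.trans ?_)
    rw [card_compl, Fintype.card_fin, hS]
    omega

variable [Fintype V]

/-- A product of sets `U \ W` consisting of linearly independent tuples is small. -/
lemma prod_card_le_of_linearIndependent {n : ℕ} {L : Submodule F V} (hL : finrank F L = n)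
    {U W : Fin n → Submodule F V} (hWU : ∀ i, W i ≤ U i) (hUL : ∀ i, U i ≤ L)
    (hne : (Fintype.piFinset fun i => diffFinset (U i) (W i)).Nonempty)
    (hli : ∀ x ∈ Fintype.piFinset fun i => diffFinset (U i) (W i), LinearIndependent F x) :
    ∏ i, #(diffFinset (U i) (W i)) ≤
      (Fintype.card F - 1) ^ n * Fintype.card F ^ (n * (n - 1) / 2) := by
  classical
  obtain ⟨x, hx⟩ := hne
  obtain ⟨f, hf⟩ := exists_multilinearMap_ne_zero_iff hL
  have hmem : ∀ y ∈ Fintype.piFinset fun i => diffFinset (U i) (W i), ∀ j, y j ∈ L :=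
    fun y hy j => hUL j (mem_diffFinset.1 (Fintype.mem_piFinset.1 hy j)).1
  have hspan : Submodule.span F (Set.range x) = L := by
    refine Submodule.eq_of_le_of_finrank_eq (Submodule.span_le.2 ?_) ?_
    · rintro _ ⟨j, rfl⟩
      exact hmem x hx j
    · rw [finrank_span_eq_card (hli x hx), hL, Fintype.card_fin]
  have h1 : ∀ i, #(diffFinset (U i) (W i)) ≤ (Fintype.card F - 1) * Nat.card (W i) := by
    intro i
    have hxi := Fintype.mem_piFinset.1 hx i
    have hfx : f.toLinearMap x i (x i) ≠ 0 := by
      simpa using (hf x (hmem x hx)).2 (hli x hx)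
    have e1 := natCard_eq_mul_natCard_inf_ker (U i) _ (mem_diffFinset.1 hxi).1 hfx
    -- A zero of the form outside `W i` would produce a dependent tuple in the box.
    have hle : U i ⊓ LinearMap.ker (f.toLinearMap x i) ≤ W i := by
      rintro v ⟨hvU, hv⟩
      by_contra hvW
      have hup : Function.update x i v ∈ Fintype.piFinset fun i => diffFinset (U i) (W i) := by
        refine Fintype.mem_piFinset.2 fun j => ?_
        by_cases hj : j = i
        · subst hj
          simpa using ⟨hvU, hvW⟩
        · simpa [hj] using Fintype.mem_piFinset.1 hx j
      exact (hf _ (hmem _ hup)).2 (hli _ hup) hv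
    have e2 := card_diffFinset_add_of_le (hWU i)
    have e3 : Nat.card (U i ⊓ LinearMap.ker (f.toLinearMap x i) : Submodule F V) ≤
        Nat.card (W i) := Nat.card_mono (Set.toFinite _) (SetLike.coe_subset_coe.2 hle)
    have e4 := Nat.mul_le_mul_left (Fintype.card F) e3
    rw [Nat.sub_mul, one_mul]
    omega
  refine (prod_le_prod' fun i _ => h1 i).trans ?_
  rw [prod_mul_distrib, prod_const, card_univ, Fintype.card_fin]
  refine Nat.mul_le_mul_left _ ?_
  -- Each `U i \ W i` is stable under translation by `W i`, so all translates `x + w` stay in the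
  -- box.
  have h2 := prod_natCard_le_prod_range (hli x hx) (W := W)
    (fun i => hspan ▸ (hWU i).trans (hUL i)) (fun w hw => hli _ ?_) n univ (by simp)
  · rwa [prod_range_reflect (fun j => Fintype.card F ^ j) n, prod_pow_eq_pow_sum, sum_range_id]
      at h2
  · refine Fintype.mem_piFinset.2 fun i => mem_diffFinset.2 ?_
    obtain ⟨h3, h4⟩ := mem_diffFinset.1 (Fintype.mem_piFinset.1 hx i)
    exact ⟨(U i).add_mem h3 (hWU i (hw i)), fun h => h4 (((W i).add_mem_iff_left (hw i)).1 h)⟩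

end Independent


/-! ### Rarity of dependent tuples -/

section Dependent

/-- Weierstrass product inequality; the induction also carries the bound of the product by 1. -/
lemma one_sub_sum_le_prod_one_sub {ι : Type*} (s : Finset ι) (f : ι → ℝ)
    (hf : ∀ i ∈ s, 0 ≤ f i ∧ f i ≤ 1) : 1 - ∑ i ∈ s, f i ≤ ∏ i ∈ s, (1 - f i) := by
  classical
  have key : 1 - ∑ i ∈ s, f i ≤ ∏ i ∈ s, (1 - f i) ∧ ∏ i ∈ s, (1 - f i) ≤ 1 := by
    induction s using Finset.induction_on with
    | empty => simp
    | insert i s hi ih =>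
      obtain ⟨h1, h2⟩ := ih fun j hj => hf j (mem_insert_of_mem hj)
      obtain ⟨h3, h4⟩ := hf i (mem_insert_self i s)
      rw [sum_insert hi, prod_insert hi]
      constructor <;> nlinarith
  exact key.1

/-- After division by `q ^ (n + 1) - 1`, each factor falls short of 1 by at most `q ^ i / q ^ (n +
1)`, and these shortfalls form a geometric sum. -/
lemma prod_sub_pow_ge {q : ℝ} (hq : 2 ≤ q) (n : ℕ) :
    (q ^ (n + 1) - 1) ^ n * (1 - 1 / (q * (q - 1))) ≤
      ∏ i : Fin n, (q ^ (n + 1) - q ^ (i : ℕ)) := by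
  have hQ1 : 1 < q ^ (n + 1) := one_lt_pow₀ (by linarith) (by omega)
  have hQ : 0 < q ^ (n + 1) - 1 := by linarith
  have hlt : ∀ i : Fin n, q ^ (i : ℕ) ≤ q ^ (n + 1) := fun i =>
    pow_le_pow_right₀ (by linarith) (by omega)
  have hge : ∀ i : Fin n, 1 ≤ q ^ (i : ℕ) := fun i => one_le_pow₀ (by linarith)
  have e1 : ∏ i : Fin n, (q ^ (n + 1) - q ^ (i : ℕ)) =
      (q ^ (n + 1) - 1) ^ n * ∏ i : Fin n, (1 - (q ^ (i : ℕ) - 1) / (q ^ (n + 1) - 1)) := by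
    rw [← Fin.prod_const n (q ^ (n + 1) - 1), ← prod_mul_distrib]
    refine prod_congr rfl fun i _ => ?_
    field_simp
    ring
  rw [e1]
  refine mul_le_mul_of_nonneg_left ?_ (by positivity)
  refine le_trans ?_ (one_sub_sum_le_prod_one_sub _ _ fun i _ =>
    ⟨div_nonneg (by linarith [hge i]) hQ.le, (div_le_one hQ).2 (by linarith [hlt i])⟩)
  refine sub_le_sub_left ?_ 1
  calc ∑ i : Fin n, (q ^ (i : ℕ) - 1) / (q ^ (n + 1) - 1)
      ≤ ∑ i : Fin n, q ^ (i : ℕ) / q ^ (n + 1) := by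
        refine sum_le_sum fun i _ => ?_
        rw [div_le_div_iff₀ hQ (by linarith)]
        nlinarith [hlt i]
    _ = (q ^ n - 1) / (q - 1) / q ^ (n + 1) := by
        rw [← sum_div, Fin.sum_univ_eq_sum_range (fun i => q ^ i), geom_sum_eq (by linarith)]
    _ ≤ 1 / (q * (q - 1)) := by
        have h1 : 0 < q - 1 := by linarith
        have h2 : 0 < q ^ n := by positivity
        rw [div_div, div_le_div_iff₀ (by positivity) (by positivity), pow_succ]
        nlinarith [mul_pos h1 (by linarith : 0 < q)]

variable {F V : Type*} [Field F] [Fintype F] [AddCommGroup V] [Module F V] [Fintype V]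

open Classical in
/-- The proportion of linearly dependent tuples among the `n`-tuples of nonzero vectors of an
`(n + 1)`-dimensional space is at most `1 / (q * (q - 1))`. -/
lemma card_not_linearIndependent_le {n : ℕ} (hV : finrank F V = n + 1) :
    (#{x : Fin n → V | (∀ j, x j ≠ 0) ∧ ¬ LinearIndependent F x} : ℝ) ≤
      ((Fintype.card F : ℝ) ^ (n + 1) - 1) ^ n * (1 / (Fintype.card F * (Fintype.card F - 1))) ∧
    (#{x : Fin n → V | ∀ j, x j ≠ 0} : ℝ) = ((Fintype.card F : ℝ) ^ (n + 1) - 1) ^ n := by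
  have hq2 : 2 ≤ Fintype.card F := Fintype.one_lt_card
  have hq : (2 : ℝ) ≤ Fintype.card F := by exact_mod_cast hq2
  have h1 : (#{x : Fin n → V | ∀ j, x j ≠ 0} : ℝ) = ((Fintype.card F : ℝ) ^ (n + 1) - 1) ^ n := by
    have h2 : ({x : Fin n → V | ∀ j, x j ≠ 0} : Finset (Fin n → V)) =
        Fintype.piFinset fun _ => univ.erase 0 := by
      ext
      simp
    rw [h2, Fintype.card_piFinset_const, card_erase_of_mem (mem_univ _), card_univ,
      card_eq_pow_finrank (K := F), hV, Nat.cast_pow, Nat.cast_sub (Nat.one_le_pow _ _ (by omega))]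
    simp
  refine ⟨?_, h1⟩
  have h2 : #{x : Fin n → V | LinearIndependent F x} =
      ∏ i : Fin n, (Fintype.card F ^ (n + 1) - Fintype.card F ^ (i : ℕ)) := by
    rw [← hV, ← card_linearIndependent (K := F) (V := V) (k := n) (by omega)]
    exact (Nat.subtype_card _ (by simp)).symm
  have h3 : (#{x : Fin n → V | LinearIndependent F x} : ℝ) =
      ∏ i : Fin n, ((Fintype.card F : ℝ) ^ (n + 1) - (Fintype.card F : ℝ) ^ (i : ℕ)) := by
    rw [h2, Nat.cast_prod]
    refine prod_congr rfl fun i _ => ?_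
    rw [Nat.cast_sub (Nat.pow_le_pow_right (by omega) (by omega))]
    simp
  have h4 := card_filter_add_card_filter_not (s := {x : Fin n → V | ∀ j, x j ≠ 0})
    (fun x => LinearIndependent F x)
  rw [filter_filter, filter_filter] at h4
  have h5 : #{x : Fin n → V | (∀ j, x j ≠ 0) ∧ LinearIndependent F x} =
      #{x : Fin n → V | LinearIndependent F x} := by
    congr 1
    ext x
    simp only [mem_filter, mem_univ, true_and, and_iff_right_iff_imp]
    exact fun h j => h.ne_zero j
  rw [h5] at h4
  have h6 := prod_sub_pow_ge hq n
  rw [← h3, ← h1] at h6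
  rw [← h1]
  rify at h4
  linarith

end Dependent

/-! ### Adding up over the partition -/

section Partition

variable {F V : Type*} [Field F] [Fintype F] [AddCommGroup V] [Module F V] [Fintype V]

-- An element `u` of `W` is the difference of `u + a` and `a`, both outside `W`.
omit [Fintype F] in
lemma le_of_diffFinset_subset {U W L : Submodule F V} {a : V} (ha : a ∈ diffFinset U W)
    (h : ∀ v ∈ diffFinset U W, v ∈ L) : U ≤ L := by
  intro u hu
  have ha' := mem_diffFinset.1 ha
  by_cases huW : u ∈ W
  · have h1 : u + a ∈ L := h _ (mem_diffFinset.2 ⟨U.add_mem hu ha'.1,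
      fun h => ha'.2 ((W.add_mem_iff_right huW).1 h)⟩)
    exact (L.add_mem_iff_left (h a ha)).1 h1
  · exact h u (mem_diffFinset.2 ⟨hu, huW⟩)

open Classical in
/-- A product of sets `U \ W` inside the `n`-th power of an `n`-dimensional space is either small
or contains a substantial proportion of linearly dependent tuples. -/
lemma prod_card_diffFinset_le {n : ℕ} (hn : 1 ≤ n) (hq : 3 ≤ Fintype.card F) {L : Submodule F V}
    (hL : finrank F L = n) {U W : Fin n → Submodule F V} (hWU : ∀ i, W i ≤ U i)
    (hUL : ∀ x ∈ Fintype.piFinset fun i => diffFinset (U i) (W i), ∀ j, x j ∈ L) :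
    (∏ i, #(diffFinset (U i) (W i)) : ℝ) ≤
      ((Fintype.card F : ℝ) - 1) ^ n * (Fintype.card F : ℝ) ^ (n * (n - 1) / 2) +
      ((Fintype.card F : ℝ) - 1) * (((Fintype.card F : ℝ) + 1) / (Fintype.card F - 2)) ^ n *
        #{x ∈ Fintype.piFinset fun i => diffFinset (U i) (W i) | ¬ LinearIndependent F x} := by
  have hq' : (3 : ℝ) ≤ Fintype.card F := by exact_mod_cast hq
  set q : ℝ := (Fintype.card F : ℝ) with hqdef
  have hc : 0 < q - 2 := by linarith
  have hpos : 0 ≤ (q - 1) ^ n * q ^ (n * (n - 1) / 2) :=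
    mul_nonneg (pow_nonneg (by linarith) _) (by positivity)
  have hprod : 0 ≤ (∏ i, #(diffFinset (U i) (W i)) : ℝ) := prod_nonneg fun _ _ => Nat.cast_nonneg _
  have hpos' : 0 ≤ (q - 1) * ((q + 1) / (q - 2)) ^ n :=
    mul_nonneg (by linarith) (by positivity)
  rcases (Fintype.piFinset fun i => diffFinset (U i) (W i)).eq_empty_or_nonempty with h0 | hne
  · have : (∏ i, #(diffFinset (U i) (W i)) : ℝ) = 0 := by
      rw [← Nat.cast_prod, ← Fintype.card_piFinset, h0]
      simp
    rw [this]
    positivity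
  have hUL' : ∀ i, U i ≤ L := by
    intro i
    obtain ⟨x, hx⟩ := hne
    refine le_of_diffFinset_subset (Fintype.mem_piFinset.1 hx i) fun v hv => ?_
    have hup : Function.update x i v ∈ Fintype.piFinset fun i => diffFinset (U i) (W i) := by
      refine Fintype.mem_piFinset.2 fun j => ?_
      by_cases hj : j = i
      · subst hj
        simpa using hv
      · simpa [hj] using Fintype.mem_piFinset.1 hx j
    simpa using hUL _ hup i
  by_cases hli : ∀ x ∈ Fintype.piFinset fun i => diffFinset (U i) (W i), LinearIndependent F x
  · have h1 := prod_card_le_of_linearIndependent hL hWU hUL' hne hli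
    have h2 : (∏ i, #(diffFinset (U i) (W i)) : ℝ) ≤ (q - 1) ^ n * q ^ (n * (n - 1) / 2) := by
      have h3 : ((Fintype.card F - 1 : ℕ) : ℝ) = q - 1 := by
        rw [Nat.cast_sub (by omega), Nat.cast_one]
      rw [← h3, hqdef]
      exact_mod_cast h1
    exact h2.trans (le_add_of_nonneg_right (by positivity))
  · push Not at hli
    obtain ⟨z, hz, hzli⟩ := hli
    refine le_trans ?_ (le_add_of_nonneg_left hpos)
    have hone : 1 ≤ (q - 1) * ((q + 1) / (q - 2)) ^ n := by
      have : 1 ≤ ((q + 1) / (q - 2)) ^ n := one_le_pow₀ ((one_le_div hc).2 (by linarith))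
      nlinarith
    -- Here the determinant vanishes on the whole box, so the estimate for forms with a nonzero
    -- value does not apply.
    by_cases hall : ∀ x ∈ Fintype.piFinset fun i => diffFinset (U i) (W i), ¬ LinearIndependent F x
    · rw [filter_true_of_mem hall, Fintype.card_piFinset, Nat.cast_prod]
      exact le_mul_of_one_le_left hprod hone
    push Not at hall
    obtain ⟨x, hx, hxli⟩ := hall
    obtain ⟨f, hf⟩ := exists_multilinearMap_ne_zero_iff hL
    have h1 := prod_card_le_card_zeros f hWU (by omega) hx hz ((hf x (hUL x hx)).2 hxli)
      (by_contra fun h => hzli ((hf z (hUL z hz)).1 h))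
    have h2 : #{v ∈ Fintype.piFinset fun i => diffFinset (U i) (W i) | f v = 0} =
        #{x ∈ Fintype.piFinset fun i => diffFinset (U i) (W i) | ¬ LinearIndependent F x} := by
      congr 1
      refine filter_congr fun v hv => ?_
      rw [← hf v (hUL v hv), not_not]
    rw [h2, Fintype.card_fin, ← hqdef] at h1
    refine le_trans ?_ (mul_le_mul_of_nonneg_left h1 hpos')
    obtain ⟨m, rfl⟩ : ∃ m, n = m + 1 := ⟨n - 1, by omega⟩
    rw [← mul_assoc]
    refine le_mul_of_one_le_left hprod ?_
    -- The factor q-2 would do; q-1 is chosen to cancel against the proportion 1/(q(q-1)) of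
    -- dependent tuples.
    have h3 : (q - 1) * ((q + 1) / (q - 2)) ^ (m + 1) *
        (((q - 2) / (q + 1)) ^ (m + 1 - 1) * (1 / (q + 1))) = (q - 1) / (q - 2) := by
      have e1 : (q + 1) / (q - 2) * ((q - 2) / (q + 1)) = 1 :=
        div_mul_div_cancel₀' (by linarith) _ _ |>.trans (div_self (by linarith))
      calc _ = (q - 1) * ((q + 1) / (q - 2) * ((q - 2) / (q + 1))) ^ m *
            ((q + 1) / (q - 2) * (1 / (q + 1))) := by rw [Nat.add_sub_cancel, mul_pow]; ring
        _ = _ := by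
          rw [e1, one_pow, div_mul_div_comm, mul_one, mul_one, mul_comm (q - 2) (q + 1),
            div_mul_cancel_left₀ (by linarith), div_eq_mul_inv]
    rw [h3, one_le_div hc]
    linarith

/-- The lower bound for partitions of the `n`-tuples of nonzero vectors. -/
lemma le_card_of_partition {n N : ℕ} (hn : 1 ≤ n) (hq : 3 ≤ Fintype.card F)
    (hV : finrank F V = n + 1) {U W : Fin N → Fin n → Submodule F V}
    (hWU : ∀ p i, W p i ≤ U p i)
    (hdisj : ∀ p p', p ≠ p' → ∀ x : Fin n → V, (∀ j, x j ∈ diffFinset (U p j) (W p j)) →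
      ¬ ∀ j, x j ∈ diffFinset (U p' j) (W p' j))
    (hcover : ∀ x : Fin n → V, (∀ j, x j ≠ 0) → ∃ p, ∀ j, x j ∈ diffFinset (U p j) (W p j))
    (hL : ∀ p, ∃ L : Submodule F V, finrank F L = n ∧
      ∀ x : Fin n → V, (∀ j, x j ∈ diffFinset (U p j) (W p j)) → ∀ j, x j ∈ L) :
    (Fintype.card F : ℝ) ^ (n * (n + 1) / 2) * (1 - 1 / (Fintype.card F : ℝ) *
      (((Fintype.card F : ℝ) + 1) / ((Fintype.card F : ℝ) - 2)) ^ n) ≤ N := by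
  classical
  obtain ⟨hdep, htot⟩ := card_not_linearIndependent_le hV
  have hq' : (3 : ℝ) ≤ Fintype.card F := by exact_mod_cast hq
  set q : ℝ := (Fintype.card F : ℝ) with hqdef
  set R : ℝ := ((q + 1) / (q - 2)) ^ n with hR
  have hR0 : 0 ≤ R := pow_nonneg (div_nonneg (by linarith) (by linarith)) _
  set B : Fin N → Finset (Fin n → V) :=
    fun p => Fintype.piFinset fun i => diffFinset (U p i) (W p i) with hB
  have hne : ∀ p, ∀ x ∈ B p, ∀ j, x j ≠ 0 := fun p x hx j h => by
    have := mem_diffFinset.1 (Fintype.mem_piFinset.1 hx j)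
    exact this.2 (h ▸ (W p j).zero_mem)
  have hBdisj : ∀ p p', p ≠ p' → Disjoint (B p) (B p') := fun p p' hpp => by
    refine Finset.disjoint_left.2 fun x hx hx' => ?_
    exact hdisj p p' hpp x (Fintype.mem_piFinset.1 hx) (Fintype.mem_piFinset.1 hx')
  have h1 : (#{x : Fin n → V | ∀ j, x j ≠ 0} : ℝ) = ∑ p, (#(B p) : ℝ) := by
    rw [← Nat.cast_sum, ← card_biUnion fun p _ p' _ h => hBdisj p p' h]
    congr 2
    ext x
    simp only [mem_filter, mem_univ, true_and, mem_biUnion]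
    exact ⟨fun h => (hcover x h).imp fun p hp => Fintype.mem_piFinset.2 hp,
      fun ⟨p, hp⟩ => hne p x hp⟩
  have h2 : ∑ p, (#{x ∈ B p | ¬ LinearIndependent F x} : ℝ) ≤
      #{x : Fin n → V | (∀ j, x j ≠ 0) ∧ ¬ LinearIndependent F x} := by
    rw [← Nat.cast_sum, ← card_biUnion fun p _ p' _ h =>
      (hBdisj p p' h).mono (filter_subset _ _) (filter_subset _ _), Nat.cast_le]
    refine card_le_card fun x hx => ?_
    obtain ⟨p, -, hp⟩ := mem_biUnion.1 hx
    obtain ⟨hp1, hp2⟩ := mem_filter.1 hp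
    exact mem_filter.2 ⟨mem_univ _, hne p x hp1, hp2⟩
  have h3 : ∀ p, (#(B p) : ℝ) ≤ (q - 1) ^ n * q ^ (n * (n - 1) / 2) +
      (q - 1) * R * #{x ∈ B p | ¬ LinearIndependent F x} := by
    intro p
    obtain ⟨L, hLn, hLx⟩ := hL p
    have := prod_card_diffFinset_le hn hq hLn (hWU p)
      fun x hx => hLx x (Fintype.mem_piFinset.1 hx)
    rwa [← Nat.cast_prod, ← Fintype.card_piFinset] at this
  have h4 := sum_le_sum fun p (_ : p ∈ univ) => h3 p
  rw [← h1, sum_add_distrib, sum_const, card_univ, Fintype.card_fin, nsmul_eq_mul, ← mul_sum,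
    htot] at h4
  set T : ℝ := (q ^ (n + 1) - 1) ^ n with hT
  set M : ℝ := (q - 1) ^ n * q ^ (n * (n - 1) / 2) with hM
  have hM0 : 0 < M := mul_pos (pow_pos (by linarith) _) (pow_pos (by linarith) _)
  have h5 : T * (1 - 1 / q * R) ≤ N * M := by
    have h6 := mul_le_mul_of_nonneg_left (h2.trans hdep)
      (mul_nonneg (by linarith : 0 ≤ q - 1) hR0)
    have h7 : (q - 1) * R * (T * (1 / (q * (q - 1)))) = T * (1 / q * R) := by
      have : q - 1 ≠ 0 := by linarith
      field_simp
    linarith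
  -- The left side is `((q - 1) * q ^ n) ^ n`.
  have h6 : M * q ^ (n * (n + 1) / 2) ≤ T := by
    have e1 : n * (n - 1) / 2 + n * (n + 1) / 2 = n * n := by
      obtain ⟨m, rfl⟩ : ∃ m, n = m + 1 := ⟨n - 1, by omega⟩
      have h8 := Nat.even_mul_succ_self m
      have h9 := Nat.even_mul_succ_self (m + 1)
      rw [Nat.add_sub_cancel, mul_comm (m + 1) m]
      have h10 : (m + 1) * (m + 1) * 2 = m * (m + 1) + (m + 1) * (m + 1 + 1) := by ring
      obtain ⟨a, ha⟩ := h8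
      obtain ⟨b, hb⟩ := h9
      omega
    rw [hM, mul_assoc, ← pow_add, e1, pow_mul, ← mul_pow]
    refine pow_le_pow_left₀ (mul_nonneg (by linarith) (by positivity)) ?_ n
    have : 1 ≤ q ^ n := one_le_pow₀ (by linarith)
    rw [pow_succ]
    linarith
  -- The bound on `T` may be multiplied by the bracket only when the bracket is nonnegative;
  -- otherwise the claim is trivial.
  rcases le_total (1 - 1 / q * R) 0 with h7 | h7
  · exact (mul_nonpos_of_nonneg_of_nonpos (by positivity) h7).trans N.cast_nonneg
  · refine le_of_mul_le_mul_right ?_ hM0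
    calc q ^ (n * (n + 1) / 2) * (1 - 1 / q * R) * M
        = M * q ^ (n * (n + 1) / 2) * (1 - 1 / q * R) := by ring
      _ ≤ T * (1 - 1 / q * R) := mul_le_mul_of_nonneg_right h6 h7
      _ ≤ N * M := h5

end Partition

/-! ### From projective flats to linear subspaces -/

/-- The cone over an almost-flat, without the origin, is a difference of two subspaces. -/
lemma IsAlmostFlat.exists_submodule {F : Type*} [Field F] {n : ℕ} {A : Set (PSpace F n)}
    (hA : IsAlmostFlat A) :
    ∃ U W : Submodule F (Fin (n + 1) → F), W ≤ U ∧
      ∀ v (hv : v ≠ 0), v ∈ U ∧ v ∉ W ↔ Projectivization.mk F v hv ∈ A := by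
  obtain ⟨L, rfl⟩ | ⟨L, M, -, rfl⟩ := hA
  · refine ⟨Projectivization.Subspace.submodule L, ⊥, bot_le, fun v hv => ?_⟩
    rw [Projectivization.Subspace.mem_submodule_iff _ hv, Submodule.mem_bot]
    simp [hv]
  -- The removed flat need not lie in `L`, so it is first intersected with `L`.
  · refine ⟨Projectivization.Subspace.submodule L, Projectivization.Subspace.submodule L ⊓
      Projectivization.Subspace.submodule M, inf_le_left, fun v hv => ?_⟩
    rw [Submodule.mem_inf, Projectivization.Subspace.mem_submodule_iff _ hv,
      Projectivization.Subspace.mem_submodule_iff _ hv, Set.mem_sdiff]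
    simp only [SetLike.mem_coe]
    tauto

end DPP


theorem theorem3 {F : Type*} [Field F] [Fintype F] (q n N : ℕ) (hcard : Fintype.card F = q)
    (hq : 3 ≤ q) (hn : 1 ≤ n) (A : Fin N → Fin n → Set (DPP.PSpace F n))
    (hA : DPP.IsValidPartition A) (hflat : ∀ i j, DPP.IsAlmostFlat (A i j)) :
    (q : ℝ) ^ (n * (n + 1) / 2) * (1 - 1 / (q : ℝ) * (((q : ℝ) + 1) / ((q : ℝ) - 2)) ^ n) ≤
      (N : ℝ) := by
  classical
  subst hcard
  choose U W hWU hUW using fun i j => (hflat i j).exists_submodule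
  have hmem : ∀ p (x : Fin n → Fin (n + 1) → F) (hx : ∀ j, x j ≠ 0),
      (∀ j, x j ∈ DPP.diffFinset (U p j) (W p j)) ↔
        (fun j => Projectivization.mk F (x j) (hx j)) ∈ DPP.part A p := fun p x hx =>
    forall_congr' fun j => by rw [DPP.mem_diffFinset, hUW p j (x j) (hx j)]
  have hne : ∀ p (x : Fin n → Fin (n + 1) → F),
      (∀ j, x j ∈ DPP.diffFinset (U p j) (W p j)) → ∀ j, x j ≠ 0 := fun p x hx j h =>
    (DPP.mem_diffFinset.1 (hx j)).2 (h ▸ (W p j).zero_mem)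
  refine DPP.le_card_of_partition hn hq (by simp) hWU ?_ ?_ ?_
  · intro p p' hpp x hx hx'
    have h0 := hne p x hx
    exact Set.disjoint_left.1 (hA.disjoint p p' hpp) ((hmem p x h0).1 hx) ((hmem p' x h0).1 hx')
  · intro x hx
    have h1 : (fun j => Projectivization.mk F (x j) (hx j)) ∈ ⋃ i, DPP.part A i :=
      hA.cover ▸ Set.mem_univ _
    obtain ⟨p, hp⟩ := Set.mem_iUnion.1 h1
    exact ⟨p, (hmem p x hx).2 hp⟩
  · intro p
    obtain ⟨L, hL, hsub⟩ := hA.subset_flat p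
    refine ⟨Projectivization.Subspace.submodule L, ?_, fun x hx j => ?_⟩
    · unfold DPP.Flat.dim at hL
      omega
    · have h0 := hne p x hx
      rw [Projectivization.Subspace.mem_submodule_iff _ (h0 j)]
      exact hsub ((hmem p x h0).1 hx) j
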